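/- Let $G$ be a finite simple plane graph: the vertices are distinct points of the plane, the edges are simple arcs joining their two ends, an edge contains no vertices other than its ends, and two distinct edges meet at most in vertices. The faces of $G$ are the connected components of the complement in the plane of the union of its vertices and edges (the unbounded one included). Assume that every face of $G$ is bounded by a cycle of even length, i.e. the topological boundary of the face is the point set of a cycle of $G$ of even length. A proper vertex coloring of $G$ is called half-monochromatic if for every face $f$ of $G$, half of the vertices on the boundary of $f$ receive the same color. Then there is a largest integer $k$ such that $G$ admits a half-monochromatic coloring that uses exactly $k$ colors, and this integer $\chi_f(G)$ satisfies $$\chi_f(G) \le \tfrac{3}{2}\,\alpha(G),$$ where $\alpha(G)$ is the independence number of $G$. -/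

import Mathlib

/-- `A` is a simple arc in the plane `ℂ = ℝ²` with endpoints `x` and `y`: the image of an injective
continuous path (an arbitrary one, not necessarily polygonal or rectifiable) from `x` to `y`. -/
def IsPlaneArc (A : Set ℂ) (x y : ℂ) : Prop :=
  ∃ γ : Path x y, Function.Injective γ ∧ Set.range γ = A

/-- A drawing of the simple graph `G` in the plane without crossings. The pair `(G, D)` is a plane
graph. Only the values of `arc` at edges of `G` are used. -/
structure SimpleGraph.PlaneDrawing {V : Type*} (G : SimpleGraph V) where
  /-- the point that represents a vertex -/
  pt : V → ℂ
  /-- the arc that represents an edge -/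
  arc : Sym2 V → Set ℂ
  pt_injective : Function.Injective pt
  isPlaneArc : ∀ u v, G.Adj u v → IsPlaneArc (arc s(u, v)) (pt u) (pt v)
  /-- an edge contains no vertices but its ends -/
  mem_of_pt_mem_arc : ∀ e ∈ G.edgeSet, ∀ w, pt w ∈ arc e → w ∈ e
  /-- two edges meet only in vertices -/
  arc_inter_subset : ∀ e ∈ G.edgeSet, ∀ e' ∈ G.edgeSet, e ≠ e' → arc e ∩ arc e' ⊆ Set.range pt

namespace SimpleGraph.PlaneDrawing

variable {V : Type*} {G : SimpleGraph V} (D : G.PlaneDrawing)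

/-- The point set of the plane graph: all its vertices and edges. -/
def support : Set ℂ := Set.range D.pt ∪ ⋃ e ∈ G.edgeSet, D.arc e

/-- The faces (the unbounded one included) are the connected components of the complement of the
point set. -/
def IsFace (f : Set ℂ) : Prop :=
  ∃ z ∈ D.supportᶜ, f = connectedComponentIn D.supportᶜ z

/-- Every face is bounded by a cycle of even length, that is, the frontier of the face is the point
set of such a cycle of `G`. -/
def HasEvenPolygonalFaces : Prop :=
  ∀ f, D.IsFace f → ∃ (v : V) (c : G.Walk v v), c.IsCycle ∧ Even c.length ∧
    frontier f = ⋃ e ∈ c.edges, D.arc e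

/-- The vertices incident with `f`: those that lie on the boundary of `f`. -/
def faceVertices (f : Set ℂ) : Set V := {v | D.pt v ∈ frontier f}

/-- A (proper) coloring is half-monochromatic if on every face some color is given to half of
the incident vertices. A proper coloring gives no color to more than half of the vertices
of an even cycle. -/
def IsHalfMonochromatic {α : Type*} (C : G.Coloring α) : Prop :=
  ∀ f, D.IsFace f → ∃ a : α,
    2 * {v ∈ D.faceVertices f | C v = a}.ncard = (D.faceVertices f).ncard

/-- There is a half-monochromatic (proper) coloring that uses exactly `k` colors. -/
def HasHalfMonochromaticColoring (k : ℕ) : Prop :=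
  ∃ C : G.Coloring (Fin k), Function.Surjective C ∧ D.IsHalfMonochromatic C

/-- The largest number of colors in a half-monochromatic coloring. -/
noncomputable def halfMonochromaticNumber : ℕ :=
  sSup {k | D.HasHalfMonochromaticColoring k}

end SimpleGraph.PlaneDrawing

/-! Let n be the number of vertices and α the independence number. If k colors are used and s of
them occur only once, then 2k ≤ n + s, so it suffices that s ≤ α and n ≤ 2α. The vertices with a
color of their own are independent: each edge lies on the boundary cycle of some face, and the color
of half of that cycle meets every edge of the cycle and occurs at least twice
(`IsHalfMonochromatic.exists_color_eq`). Hence s ≤ α. For n ≤ 2α the graph is shown to be bipartite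
(`HasEvenPolygonalFaces.exists_signs`) by a covering argument that avoids the Jordan curve theorem.
Alternating signs on the even boundary cycle of a face, joined by half turns along the edges, form a
nonvanishing continuous function on its frontier. At every point the functions of two faces agree up
to sign. The plane is simply connected, so they lift through a double cover, the quotient of nonzero
vectors by ±1, to one continuous φ. Along an edge the ratio of φ to the function of an incident face
is a constant ±1, so φ changes sign between the ends. A 2-coloring is itself half-monochromatic, so
the maximum is taken over a nonempty set. -/

open Topology Set

/-! ### Gluing up to sign by a double cover -/

/-- The units of `ℤ` act on the nonzero vectors by sign changes. -/
instance nonzeroSignAction (W : Type*) [AddCommGroup W] : MulAction ℤˣ {w : W // w ≠ 0} where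
  smul u w := ⟨u • w.1, (smul_ne_zero_iff_ne u).2 w.2⟩
  one_smul w := Subtype.ext (one_smul _ w.1)
  mul_smul u v w := Subtype.ext (mul_smul u v w.1)

theorem coe_nonzeroSignAction_smul {W : Type*} [AddCommGroup W] (u : ℤˣ) (w : {w : W // w ≠ 0}) :
    ((u • w : {w : W // w ≠ 0}) : W) = u • (w : W) := rfl

theorem isQuotientCoveringMap_nonzeroSignAction (W : Type*) [NormedAddCommGroup W]
    [NormedSpace ℝ W] :
    IsQuotientCoveringMap
      (Quotient.mk (MulAction.orbitRel ℤˣ {w : W // w ≠ 0})) ℤˣ where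
  __ := isQuotientMap_quotient_mk'
  continuous_const_smul u := by
    refine Continuous.subtype_mk ?_ _
    rcases Int.units_eq_one_or u with rfl | rfl
    · simpa using continuous_subtype_val
    · simpa using (continuous_subtype_val (p := fun w : W => w ≠ 0)).fun_neg
  apply_eq_iff_mem_orbit := Quotient.eq''
  disjoint e := by
    -- If `x` and `-x` were both closer than `‖e‖` to `e`, the triangle inequality would give `2‖e‖
    -- < 2‖e‖`.
    refine ⟨Metric.ball e ‖(e : W)‖, Metric.ball_mem_nhds _ (norm_pos_iff.2 e.2), fun u hu => ?_⟩
    rcases Int.units_eq_one_or u with rfl | rfl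
    · rfl
    · obtain ⟨_, ⟨x, hx, rfl⟩, hy⟩ := hu
      exfalso
      simp only [Metric.mem_ball, Subtype.dist_eq, dist_eq_norm, coe_nonzeroSignAction_smul,
        Units.neg_smul, one_smul] at hx hy
      have h := norm_sub_le (-(x : W) - e) (e - x)
      have h2 : (-(x : W) - e) - (e - x) = (-2 : ℝ) • (e : W) := by module
      rw [h2, norm_smul, norm_sub_rev (e : W)] at h
      norm_num at h
      linarith

/-- Nonvanishing vector fields on the pieces of a finite closed cover of a simply connected space
that agree up to sign can be glued up to sign. -/
theorem exists_continuous_eq_or_eq_neg {X W ι : Type*} [TopologicalSpace X]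
    [SimplyConnectedSpace X] [LocallyPathConnectedSpace X] [NormedAddCommGroup W]
    [NormedSpace ℝ W] [Finite ι] {A : ι → Set X} (hA : ∀ i, IsClosed (A i)) (hcov : ⋃ i, A i = univ)
    {s : ι → X → W} (hs : ∀ i, ContinuousOn (s i) (A i)) (h0 : ∀ i, ∀ x ∈ A i, s i x ≠ 0)
    (hss : ∀ i j, ∀ x ∈ A i, x ∈ A j → s i x = s j x ∨ s i x = -s j x) :
    ∃ φ : X → W, Continuous φ ∧ ∀ i, ∀ x ∈ A i, φ x = s i x ∨ φ x = -s i x := by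
  have hx : ∀ x, ∃ i, x ∈ A i := fun x => mem_iUnion.1 (hcov ▸ mem_univ x)
  choose i hi using hx
  let q := Quotient.mk (MulAction.orbitRel ℤˣ {w : W // w ≠ 0})
  have hq := isQuotientCoveringMap_nonzeroSignAction W
  have hqeq : ∀ a b : {w : W // w ≠ 0}, q a = q b ↔ ((a : W) = b ∨ (a : W) = -b) := by
    intro a b
    rw [hq.apply_eq_iff_mem_orbit]
    constructor
    · rintro ⟨u, rfl⟩
      rcases Int.units_eq_one_or u with rfl | rfl
      · exact Or.inl (one_smul _ _)
      · exact Or.inr (by simp [coe_nonzeroSignAction_smul])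
    · rintro (h | h)
      · exact ⟨1, Subtype.ext (by simp [h])⟩
      · exact ⟨-1, Subtype.ext (by simp [h, coe_nonzeroSignAction_smul])⟩
  -- Modulo sign the choice of the piece `i x` is immaterial, so `F` is continuous on each closed
  -- piece.
  let F : X → Quotient (MulAction.orbitRel ℤˣ {w : W // w ≠ 0}) :=
    fun x => q ⟨s (i x) x, h0 _ x (hi x)⟩
  have hF : Continuous F := by
    refine (locallyFinite_of_finite A).continuous hcov hA fun j => ?_
    rw [continuousOn_iff_continuous_domRestrict]
    have h1 : (A j).domRestrict F = fun x : A j => q ⟨s j x, h0 j x x.2⟩ := by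
      funext x
      exact (hqeq _ _).2 (hss _ _ x (hi x) x.2)
    rw [h1]
    exact hq.continuous.comp (Continuous.subtype_mk (continuousOn_iff_continuous_domRestrict.1 (hs j)) _)
  obtain ⟨x₀⟩ : Nonempty X := inferInstance
  obtain ⟨φ, ⟨-, hφ⟩, -⟩ := hq.isCoveringMap.existsUnique_continuousMap_lifts ⟨F, hF⟩ x₀
    ⟨s (i x₀) x₀, h0 _ x₀ (hi x₀)⟩ rfl
  refine ⟨fun x => φ x, continuous_subtype_val.comp φ.continuous, fun j x hxj => ?_⟩
  have h1 : q (φ x) = q ⟨s j x, h0 j x hxj⟩ :=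
    (congrFun hφ x).trans ((hqeq _ _).2 (hss _ _ x (hi x) hxj))
  exact (hqeq _ _).1 h1

/-! ### Frontiers of complementary components -/

theorem connectedComponentIn_eq_of_inter_nonempty {X : Type*} [TopologicalSpace X] {U : Set X}
    {x y z : X} (hx : z ∈ connectedComponentIn U x) (hy : z ∈ connectedComponentIn U y) :
    connectedComponentIn U x = connectedComponentIn U y :=
  (connectedComponentIn_eq hx).trans (connectedComponentIn_eq hy).symm

/-- The frontier of a component of an open set lies outside of the open set. -/
theorem frontier_connectedComponentIn_subset {X : Type*} [TopologicalSpace X]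
    [LocallyConnectedSpace X] {K : Set X} (hK : IsClosed K) (z : X) :
    frontier (connectedComponentIn Kᶜ z) ⊆ K := by
  intro x hx
  by_contra hxK
  have ho : ∀ w, IsOpen (connectedComponentIn Kᶜ w) := fun w => hK.isOpen_compl.connectedComponentIn
  have h1 : x ∈ connectedComponentIn Kᶜ x := mem_connectedComponentIn hxK
  obtain ⟨y, hy, hyz⟩ := mem_closure_iff.1 hx.1 _ (ho x) h1
  rw [(ho z).frontier_eq] at hx
  exact hx.2 (connectedComponentIn_eq_of_inter_nonempty hyz hy ▸ h1)

theorem IsPreconnected.inter_frontier_nonempty_of_isOpen {X : Type*} [TopologicalSpace X]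
    {s u : Set X} (hs : IsPreconnected s) (hu : IsOpen u) (h1 : (s ∩ u).Nonempty)
    (h2 : ¬ s ⊆ u) : (s ∩ frontier u).Nonempty := by
  by_contra h
  refine h2 (hs.subset_of_closure_inter_subset hu h1 fun x hx => ?_)
  by_contra hxu
  exact h ⟨x, hx.2, hu.frontier_eq ▸ ⟨hx.1, hxu⟩⟩

/-- A limit of points of components of the complement of `K` with frontier in a closed set `Z`
that lies in `K` belongs to `Z`. -/
theorem mem_of_mem_closure_of_frontier_subset {E : Type*} [NormedAddCommGroup E] [NormedSpace ℝ E]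
    {K Z : Set E} (hK : IsClosed K) (hZ : IsClosed Z) {x : E} (hx : x ∈ K)
    (h : x ∈ closure {z | z ∈ Kᶜ ∧ frontier (connectedComponentIn Kᶜ z) ⊆ Z}) : x ∈ Z := by
  rw [← hZ.closure_eq, Metric.mem_closure_iff]
  intro ε hε
  obtain ⟨z, ⟨hzK, hzZ⟩, hxz⟩ := Metric.mem_closure_iff.1 h ε hε
  have hseg : segment ℝ x z ⊆ Metric.ball x ε :=
    (convex_ball x ε).segment_subset (Metric.mem_ball_self hε) (by rwa [Metric.mem_ball, dist_comm])
  -- The segment joins `z`, in the component, to `x`, outside it, so it meets the frontier within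
  -- `ε` of `x`.
  obtain ⟨y, hy, hyf⟩ := (convex_segment x z).isPreconnected.inter_frontier_nonempty_of_isOpen
    (u := connectedComponentIn Kᶜ z) hK.isOpen_compl.connectedComponentIn
    ⟨z, right_mem_segment ℝ x z, mem_connectedComponentIn hzK⟩
    fun h' => connectedComponentIn_subset _ _ (h' (left_mem_segment ℝ x z)) hx
  exact ⟨y, hzZ hyf, by simpa [dist_comm] using hseg hy⟩

/-- If the complement of `K` is dense and its components have finitely many frontiers,
then these frontiers cover `K`. -/
theorem exists_mem_frontier_connectedComponentIn {E : Type*} [NormedAddCommGroup E]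
    [NormedSpace ℝ E] {K : Set E} (hK : IsClosed K) (hint : interior K = ∅)
    (hfin : {Z | ∃ z ∈ Kᶜ, Z = frontier (connectedComponentIn Kᶜ z)}.Finite) {x : E} (hx : x ∈ K) :
    ∃ z ∈ Kᶜ, x ∈ frontier (connectedComponentIn Kᶜ z) := by
  set 𝒵 := {Z | ∃ z ∈ Kᶜ, Z = frontier (connectedComponentIn Kᶜ z)} with h𝒵
  have hcl : IsClosed (⋃₀ 𝒵) := by
    rw [sUnion_eq_biUnion]
    exact Set.Finite.isClosed_biUnion hfin (by
      rintro _ ⟨z, -, rfl⟩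
      exact isClosed_frontier)
  have hmem := mem_of_mem_closure_of_frontier_subset hK hcl hx (by
    refine closure_mono (s := Kᶜ) (t := {z | z ∈ Kᶜ ∧ frontier (connectedComponentIn Kᶜ z) ⊆ ⋃₀ 𝒵})
      (fun z hz => ⟨hz, subset_sUnion_of_mem (h𝒵 ▸ ⟨z, hz, rfl⟩)⟩) ?_
    rw [closure_compl, hint]
    simp)
  obtain ⟨_, ⟨z, hz, rfl⟩, hxz⟩ := hmem
  exact ⟨z, hz, hxz⟩

/-- Nonvanishing functions on the frontiers of the components of the complement of `K` that agree
up to sign can be glued up to sign. -/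
theorem exists_continuous_eq_or_eq_neg_on_frontier {K : Set ℂ} (hK : IsClosed K)
    (hint : interior K = ∅)
    (hfin : {Z | ∃ z ∈ Kᶜ, Z = frontier (connectedComponentIn Kᶜ z)}.Finite)
    {s : Set ℂ → ℂ → ℂ}
    (hs : ∀ z ∈ Kᶜ, ContinuousOn (s (frontier (connectedComponentIn Kᶜ z)))
      (frontier (connectedComponentIn Kᶜ z)))
    (h0 : ∀ Z, ∀ x, s Z x ≠ 0)
    (hss : ∀ Z Z', ∀ x, s Z x = s Z' x ∨ s Z x = -s Z' x) :
    ∃ φ : ℂ → ℂ, Continuous φ ∧ ∀ x ∈ K, ∀ Z, φ x = s Z x ∨ φ x = -s Z x := by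
  rcases K.eq_empty_or_nonempty with rfl | hne
  · exact ⟨0, continuous_zero, by simp⟩
  set 𝒵 := {Z | ∃ z ∈ Kᶜ, Z = frontier (connectedComponentIn Kᶜ z)} with h𝒵
  have := hfin.to_subtype
  have hZ : ∀ Z : 𝒵, IsClosed (Z : Set ℂ) := by
    rintro ⟨_, z, -, rfl⟩; exact isClosed_frontier
  have hZK : ∀ Z : 𝒵, (Z : Set ℂ) ⊆ K := by
    rintro ⟨_, z, -, rfl⟩; exact frontier_connectedComponentIn_subset hK z
  have hext : ∀ Z : 𝒵, ∃ t : C(ℂ, ℂ), ∀ x ∈ (Z : Set ℂ), t x = s Z x := by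
    intro Z
    have hc : ContinuousOn (s Z) (Z : Set ℂ) := by
      obtain ⟨_, z, hz, rfl⟩ := Z; exact hs z hz
    obtain ⟨t, ht⟩ := ContinuousMap.exists_restrict_eq (hZ Z)
      ⟨(Z : Set ℂ).domRestrict (s Z), continuousOn_iff_continuous_domRestrict.1 hc⟩
    exact ⟨t, fun x hx => DFunLike.congr_fun ht ⟨x, hx⟩⟩
  choose t ht using hext
  -- Components are grouped by frontier, so the cover is finite without any bound on the number of
  -- components.
  let A : 𝒵 → Set ℂ := fun Z => Z ∪ {z | z ∈ Kᶜ ∧ frontier (connectedComponentIn Kᶜ z) = Z}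
  have hAK : ∀ Z, ∀ x ∈ A Z, x ∈ K → x ∈ (Z : Set ℂ) := by
    rintro Z x (h | h) hx
    · exact h
    · exact absurd hx h.1
  have hA : ∀ Z, IsClosed (A Z) := by
    intro Z
    refine isClosed_of_closure_subset fun x hx => ?_
    rw [closure_union, (hZ Z).closure_eq] at hx
    rcases hx with hx | hx
    · exact Or.inl hx
    by_cases hxK : x ∈ K
    · exact Or.inl (mem_of_mem_closure_of_frontier_subset hK (hZ Z) hxK
        (closure_mono
          (t := {z | z ∈ Kᶜ ∧ frontier (connectedComponentIn Kᶜ z) ⊆ Z})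
          (fun z hz => ⟨hz.1, hz.2.subset⟩) hx))
    · obtain ⟨y, hy, hyK, hyZ⟩ := mem_closure_iff.1 hx _
        (hK.isOpen_compl.connectedComponentIn (x := x)) (mem_connectedComponentIn hxK)
      exact Or.inr ⟨hxK, by rw [connectedComponentIn_eq hy, hyZ]⟩
  have hcov : ⋃ Z, A Z = univ := by
    refine eq_univ_of_forall fun x => mem_iUnion.2 ?_
    by_cases hxK : x ∈ K
    · obtain ⟨z, hz, hxz⟩ := exists_mem_frontier_connectedComponentIn hK hint hfin hxK
      exact ⟨⟨_, z, hz, rfl⟩, Or.inl hxz⟩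
    · exact ⟨⟨_, x, hxK, rfl⟩, Or.inr ⟨hxK, rfl⟩⟩
  -- The Tietze extensions may vanish off `K`. The distance to `K` as a second coordinate keeps the
  -- pair nonzero there, and it is 0 on `K`, where signs must match.
  obtain ⟨φ, hφ, hφs⟩ := exists_continuous_eq_or_eq_neg (W := ℂ × ℝ) hA hcov
    (s := fun Z x => (t Z x, Metric.infDist x K))
    (fun Z => ((t Z).continuous.prodMk (Metric.continuous_infDist_pt K)).continuousOn)
    (by
      intro Z x hx h
      rw [Prod.mk_eq_zero] at h
      have hxK := (hK.mem_iff_infDist_zero hne).2 h.2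
      exact h0 Z x (ht Z x (hAK Z x hx hxK) ▸ h.1))
    (by
      intro Z Z' x hx hx'
      by_cases hxK : x ∈ K
      · have h1 := (hK.mem_iff_infDist_zero hne).1 hxK
        simp only [h1, ht Z x (hAK Z x hx hxK), ht Z' x (hAK Z' x hx' hxK), Prod.neg_mk, neg_zero,
          Prod.mk.injEq, and_true]
        exact hss Z Z' x
      · have h1 : ∀ Z, x ∈ A Z → frontier (connectedComponentIn Kᶜ x) = Z := fun Z h =>
          h.elim (fun h => absurd (hZK Z h) hxK) And.right
        left
        rw [Subtype.ext ((h1 Z hx).symm.trans (h1 Z' hx'))])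
  refine ⟨fun x => (φ x).1, continuous_fst.comp hφ, fun x hxK Z' => ?_⟩
  obtain ⟨Z, hx⟩ := mem_iUnion.1 (hcov ▸ mem_univ x)
  have h1 : (φ x).1 = s Z x ∨ (φ x).1 = -s Z x := by
    rw [← ht Z x (hAK Z x hx hxK)]
    exact (hφs Z x hx).imp (congrArg Prod.fst) (congrArg Prod.fst)
  rcases h1 with h1 | h1 <;> rcases hss Z Z' x with h2 | h2 <;> simp [h1, h2]

/-! ### Arcs have empty interior -/

/-- A disc stays connected when a point is removed. -/
theorem isPreconnected_ball_diff_singleton {z p : ℂ} {r : ℝ} (hp : p ∈ Metric.ball z r) :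
    IsPreconnected (Metric.ball z r \ {p}) := by
  have hr : 0 < r := Metric.pos_of_mem_ball hp
  let f := OpenPartialHomeomorph.univBall z r
  have htar : f.target = Metric.ball z r := OpenPartialHomeomorph.univBall_target z hr
  have hsrc : f.source = univ := OpenPartialHomeomorph.univBall_source z r
  have himg : f '' {f.symm p}ᶜ = Metric.ball z r \ {p} := by
    ext w
    constructor
    · rintro ⟨v, hv, rfl⟩
      have hvs : v ∈ f.source := hsrc ▸ mem_univ v
      refine ⟨htar ▸ f.map_source hvs, fun h => hv ?_⟩
      rw [mem_singleton_iff, ← mem_singleton_iff.1 h, f.left_inv hvs]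
    · rintro ⟨hw, hwp⟩
      refine ⟨f.symm w, fun h => hwp ?_, f.right_inv (htar ▸ hw)⟩
      rw [mem_singleton_iff] at h ⊢
      rw [← f.right_inv (htar ▸ hw : w ∈ f.target), h, f.right_inv (htar ▸ hp)]
  rw [← himg]
  refine ((isConnected_compl_singleton_of_one_lt_rank (by simp) _).isPreconnected).image _ ?_
  exact f.continuousOn.mono (hsrc ▸ subset_univ _)

/-- An arc in the plane has empty interior. -/
theorem IsPlaneArc.interior_eq_empty {A : Set ℂ} {x y : ℂ} (h : IsPlaneArc A x y) :
    interior A = ∅ := by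
  obtain ⟨γ, hγ, rfl⟩ := h
  have hemb := γ.continuous.isClosedEmbedding hγ
  by_contra hne
  obtain ⟨z, hz⟩ := nonempty_iff_ne_empty.2 hne
  obtain ⟨r, hr, hball⟩ := Metric.isOpen_iff.1 isOpen_interior z hz
  have hball : Metric.ball z r ⊆ range γ := hball.trans interior_subset
  have hpre : γ '' (γ ⁻¹' Metric.ball z r) = Metric.ball z r := image_preimage_eq_of_subset hball
  have hinf : (γ ⁻¹' Metric.ball z r).Infinite := by
    refine Infinite.of_image γ ?_
    rw [hpre]
    exact infinite_of_mem_nhds z (Metric.ball_mem_nhds z hr)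
  -- Of three parameters mapped into the disc, the image of the middle one is removed: the disc
  -- stays connected, while its preimage in the interval is cut.
  obtain ⟨T, hT, hcard⟩ := hinf.exists_subset_card_eq 3
  have hmem : ∀ i, T.orderEmbOfFin hcard i ∈ γ ⁻¹' Metric.ball z r :=
    fun i => hT (T.orderEmbOfFin_mem hcard i)
  have hlt : ∀ i j, i < j → T.orderEmbOfFin hcard i < T.orderEmbOfFin hcard j :=
    fun i j h => (T.orderEmbOfFin hcard).strictMono h
  set t := T.orderEmbOfFin hcard
  have himg : γ '' (γ ⁻¹' (Metric.ball z r \ {γ (t 1)})) = Metric.ball z r \ {γ (t 1)} :=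
    image_preimage_eq_of_subset (sdiff_subset.trans hball)
  have hconn := isPreconnected_ball_diff_singleton (hmem 1)
  rw [← himg, hemb.isInducing.isPreconnected_image] at hconn
  have hne : ∀ i, i ≠ 1 → t i ∈ γ ⁻¹' (Metric.ball z r \ {γ (t 1)}) :=
    fun i hi => ⟨hmem i, fun h => hi (t.injective (hγ h))⟩
  exact (hconn.ordConnected.out (hne 0 (by decide)) (hne 2 (by decide))
    ⟨(hlt 0 1 (by decide)).le, (hlt 1 2 (by decide)).le⟩).2 rfl

/-! ### Cycles indexed by `ZMod L` -/

/-- `T` and its shift by one are disjoint and each has half of the elements, so together they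
exhaust `ZMod L`. -/
theorem ZMod.mem_or_add_one_mem_of_ncard {L : ℕ} [NeZero L] {T : Set (ZMod L)}
    (hT : ∀ i ∈ T, i + 1 ∉ T) (hcard : 2 * T.ncard = L) (i : ZMod L) : i ∈ T ∨ i + 1 ∈ T := by
  have hd : Disjoint T ((· + 1) '' T) := by
    rw [Set.disjoint_right]
    rintro _ ⟨j, hj, rfl⟩
    exact hT j hj
  have hu : T ∪ (· + 1) '' T = univ := by
    refine Set.eq_of_subset_of_ncard_le (subset_univ _) ?_ (Set.toFinite _)
    rw [Set.ncard_union_eq hd (Set.toFinite _) (Set.toFinite _),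
      Set.ncard_image_of_injective _ (add_left_injective 1), ncard_univ, Nat.card_zmod]
    lia
  rcases hu ▸ mem_univ (i + 1) with h | ⟨j, hj, h⟩
  · exact Or.inr h
  · exact Or.inl (add_left_injective 1 h ▸ hj)

/-- The shift by one exchanges the two color classes. -/
theorem ZMod.two_mul_ncard_of_alternating {L : ℕ} [NeZero L] {c : ZMod L → Fin 2}
    (hc : ∀ i, c i ≠ c (i + 1)) : 2 * {i | c i = 0}.ncard = L := by
  have h : (· + 1) '' {i | c i = 0} = {i | c i = 0}ᶜ := by
    ext i
    have := hc (i - 1)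
    rw [sub_add_cancel] at this
    simp only [mem_image, mem_ofPred_eq, mem_compl_iff]
    constructor
    · rintro ⟨j, hj, rfl⟩ h
      exact hc j (hj.trans h.symm)
    · intro h
      exact ⟨i - 1, by lia, sub_add_cancel _ _⟩
  have h2 := Set.ncard_add_ncard_compl {i | c i = 0}
  rw [← h, Set.ncard_image_of_injective _ (add_left_injective 1), Nat.card_zmod] at h2
  lia

theorem exists_alternating_sign {V : Type*} {L : ℕ} (hL : Even L) {p : ZMod L → V}
    (hp : Function.Injective p) :
    ∃ c : V → ℂ, (∀ v, c v = 1 ∨ c v = -1) ∧ ∀ i, c (p i) = -c (p (i + 1)) := by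
  classical
  -- Parity is well defined modulo the even number `L`. Off the cycle the sign defaults to 1.
  let f := ZMod.castHom hL.two_dvd (ZMod 2)
  refine ⟨Function.extend p (fun i => if f i = 0 then 1 else -1) 1, fun v => ?_, fun i => ?_⟩
  · rw [Function.extend_def]
    split_ifs <;> simp
  · rw [hp.extend_apply, hp.extend_apply, map_add, map_one]
    have h01 : ∀ a : ZMod 2, a = 0 ∨ a = 1 := by decide
    have h2 : (1 + 1 : ZMod 2) = 0 := by decide
    rcases h01 (f i) with h | h <;> simp [h, h2]

theorem SimpleGraph.Walk.IsCycle.exists_zmod {V : Type*} {G : SimpleGraph V} {v : V}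
    {c : G.Walk v v} (hc : c.IsCycle) :
    ∃ p : ZMod c.length → V, Function.Injective p ∧
      ∀ e, e ∈ c.edges ↔ ∃ i, s(p i, p (i + 1)) = e := by
  have h3 := hc.three_le_length
  have : NeZero c.length := ⟨by lia⟩
  have hp : ∀ n ≤ c.length, c.getVert (n : ZMod c.length).val = c.getVert n := by
    intro n hn
    rw [ZMod.val_natCast]
    rcases hn.eq_or_lt with rfl | hn
    · simp
    · rw [Nat.mod_eq_of_lt hn]
  have hp1 : ∀ i : ZMod c.length, c.getVert (i + 1).val = c.getVert (i.val + 1) := by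
    intro i
    rw [← hp _ (ZMod.val_lt i)]
    simp
  refine ⟨fun i => c.getVert i.val, fun i j hij => ZMod.val_injective _ (hc.getVert_injOn' ?_ ?_ hij),
    fun e => ?_⟩
  · exact Nat.le_sub_one_of_lt (ZMod.val_lt i)
  · exact Nat.le_sub_one_of_lt (ZMod.val_lt j)
  induction e with | _ a b
  rw [c.mk_mem_edges_iff_exists]
  simp only [hp1]
  constructor
  · rintro ⟨n, hn, h⟩
    refine ⟨n, ?_⟩
    rw [ZMod.val_natCast, Nat.mod_eq_of_lt hn, h]
  · rintro ⟨i, h⟩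
    exact ⟨i.val, ZMod.val_lt i, h⟩

/-! ### Face boundaries and bipartiteness -/

namespace SimpleGraph.PlaneDrawing

variable {V : Type*} {G : SimpleGraph V} (D : G.PlaneDrawing)

theorem isPlaneArc_of_mem_edgeSet {e : Sym2 V} (he : e ∈ G.edgeSet) :
    ∃ u v, IsPlaneArc (D.arc e) (D.pt u) (D.pt v) := by
  induction e with | _ u v
  exact ⟨u, v, D.isPlaneArc u v he⟩

theorem isClosed_arc {e : Sym2 V} (he : e ∈ G.edgeSet) : IsClosed (D.arc e) := by
  obtain ⟨u, v, γ, -, h⟩ := D.isPlaneArc_of_mem_edgeSet he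
  exact h ▸ (isCompact_range γ.continuous).isClosed

theorem isClosed_support [Finite V] : IsClosed D.support :=
  (finite_range D.pt).isClosed.union
    ((toFinite G.edgeSet).isClosed_biUnion fun _ he => D.isClosed_arc he)

theorem interior_support [Finite V] : interior D.support = ∅ := by
  have h1 : interior (⋃ e ∈ G.edgeSet, D.arc e) = ∅ := by
    rw [interior_eq_empty_iff_dense_compl, compl_iUnion₂]
    refine dense_biInter_of_isOpen (fun e he => (D.isClosed_arc he).isOpen_compl)
      (toFinite G.edgeSet).countable fun e he => ?_
    obtain ⟨u, v, h⟩ := D.isPlaneArc_of_mem_edgeSet he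
    exact interior_eq_empty_iff_dense_compl.1 h.interior_eq_empty
  rw [support, interior_union_isClosed_of_interior_empty (finite_range D.pt).isClosed h1]
  exact interior_eq_empty_iff_dense_compl.2 ((finite_range D.pt).countable.dense_compl ℝ)

variable {D}

/-- A frontier is determined by the edge set of its cycle, and there are finitely many such sets. -/
theorem HasEvenPolygonalFaces.finite_frontiers [Finite V] (hD : D.HasEvenPolygonalFaces) :
    {Z | ∃ z ∈ D.supportᶜ, Z = frontier (connectedComponentIn D.supportᶜ z)}.Finite := by
  refine (finite_range fun S : Set (Sym2 V) => ⋃ e ∈ S, D.arc e).subset ?_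
  rintro _ ⟨z, hz, rfl⟩
  obtain ⟨v, c, -, -, h⟩ := hD _ ⟨z, hz, rfl⟩
  exact ⟨{e | e ∈ c.edges}, h.symm⟩

theorem HasEvenPolygonalFaces.exists_zmod (hD : D.HasEvenPolygonalFaces) {f : Set ℂ}
    (hf : D.IsFace f) :
    ∃ (L : ℕ) (p : ZMod L → V), 3 ≤ L ∧ Even L ∧ Function.Injective p ∧
      (∀ i, G.Adj (p i) (p (i + 1))) ∧ frontier f = ⋃ i, D.arc s(p i, p (i + 1)) ∧
      D.faceVertices f = range p := by
  obtain ⟨v, c, hc, hev, hfr⟩ := hD f hf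
  obtain ⟨p, hp, hpe⟩ := hc.exists_zmod
  have hadj : ∀ i, G.Adj (p i) (p (i + 1)) := fun i => c.edges_subset_edgeSet ((hpe _).2 ⟨i, rfl⟩)
  have hfr' : frontier f = ⋃ i, D.arc s(p i, p (i + 1)) := by
    rw [hfr]
    ext x
    simp only [mem_iUnion, exists_prop, hpe]
    constructor
    · rintro ⟨_, ⟨i, rfl⟩, hx⟩
      exact ⟨i, hx⟩
    · rintro ⟨i, hx⟩
      exact ⟨_, ⟨i, rfl⟩, hx⟩
  refine ⟨c.length, p, hc.three_le_length, hev, hp, hadj, hfr', ?_⟩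
  ext w
  rw [faceVertices, mem_ofPred_eq, hfr', mem_iUnion]
  constructor
  · rintro ⟨i, hi⟩
    rcases Sym2.mem_iff.1 (D.mem_of_pt_mem_arc _ (hadj i) w hi) with rfl | rfl <;>
      exact mem_range_self _
  · rintro ⟨i, rfl⟩
    refine ⟨i, ?_⟩
    obtain ⟨γ, -, h⟩ := D.isPlaneArc _ _ (hadj i)
    exact h ▸ ⟨0, γ.source⟩

/-- Every edge runs along a face. -/
theorem HasEvenPolygonalFaces.exists_isFace_of_mem_edgeSet [Finite V]
    (hD : D.HasEvenPolygonalFaces) {e : Sym2 V} (he : e ∈ G.edgeSet) :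
    ∃ f, D.IsFace f ∧ ∃ x ∈ frontier f, x ∈ D.arc e ∧ x ∉ range D.pt := by
  obtain ⟨u, v, γ, hγ, h⟩ := D.isPlaneArc_of_mem_edgeSet he
  have : Infinite unitInterval := (Icc_infinite zero_lt_one).to_subtype
  have hinf : (D.arc e).Infinite := h ▸ infinite_range_of_injective hγ
  obtain ⟨x, hx, hxv⟩ := (hinf.sdiff (finite_range D.pt)).nonempty
  obtain ⟨z, hz, hxz⟩ := exists_mem_frontier_connectedComponentIn D.isClosed_support
    D.interior_support hD.finite_frontiers (Or.inr (mem_biUnion he hx))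
  exact ⟨_, ⟨z, hz, rfl⟩, x, hxz, hx, hxv⟩

/-- An inner point of an edge lies on no other edge. -/
theorem eq_of_mem_arc {e e' : Sym2 V} (he : e ∈ G.edgeSet) (he' : e' ∈ G.edgeSet) {x : ℂ}
    (hx : x ∈ D.arc e) (hx' : x ∈ D.arc e') (hxv : x ∉ range D.pt) : e = e' := by
  by_contra h
  exact hxv (D.arc_inter_subset e he e' he' h ⟨hx, hx'⟩)

/-- A half turn along an edge. -/
theorem exists_halfTurn (D : G.PlaneDrawing) {e : Sym2 V} (he : e ∈ G.edgeSet) :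
    ∃ (a b : V) (E : ℂ → ℂ), e = s(a, b) ∧ ContinuousOn E (D.arc e) ∧ (∀ x, E x ≠ 0) ∧
      E (D.pt a) = 1 ∧ E (D.pt b) = -1 := by
  induction e with | _ a b
  obtain ⟨γ, hγ, h⟩ := D.isPlaneArc a b he
  have hemb := (γ.continuous.isClosedEmbedding hγ).isEmbedding
  let t : ℂ → ℝ := fun x => (Function.invFun γ x : unitInterval)
  have ht : ∀ i, t (γ i) = i := fun i => congrArg Subtype.val (Function.leftInverse_invFun hγ i)
  refine ⟨a, b, fun x => Complex.exp (Real.pi * t x * Complex.I), rfl, ?_,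
    fun x => Complex.exp_ne_zero _, ?_, ?_⟩
  · rw [← h, continuousOn_iff_continuous_domRestrict]
    have h1 : (range γ).domRestrict (fun x => Complex.exp (Real.pi * t x * Complex.I)) =
        fun x => Complex.exp (Real.pi * (hemb.toHomeomorph.symm x : ℝ) * Complex.I) := by
      funext x
      obtain ⟨i, rfl⟩ := hemb.toHomeomorph.surjective x
      rw [Homeomorph.symm_apply_apply]
      change Complex.exp (Real.pi * t (γ i) * Complex.I) = _
      rw [ht]
    rw [h1]
    fun_prop
  · have := ht 0
    rw [γ.source] at this
    simp [this]
  · have := ht 1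
    rw [γ.target] at this
    simp [this]

/-- Signs at the vertices extend along the edges to a nonvanishing function that is unique up to
sign and is continuous along the edges at whose ends the signs differ. -/
theorem exists_signExtension (D : G.PlaneDrawing) :
    ∃ S : (V → ℂ) → ℂ → ℂ, (∀ c v, S c (D.pt v) = c v) ∧
      (∀ c, (∀ v, c v = 1 ∨ c v = -1) → ∀ x, S c x ≠ 0) ∧
      (∀ c c', (∀ v, c v = 1 ∨ c v = -1) → (∀ v, c' v = 1 ∨ c' v = -1) →
        ∀ x, S c x = S c' x ∨ S c x = -S c' x) ∧
      ∀ c u v, G.Adj u v → c u = -c v → ContinuousOn (S c) (D.arc s(u, v)) := by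
  classical
  choose a b E heq hE h0 ha hb using fun e (he : e ∈ G.edgeSet) => D.exists_halfTurn he
  -- On an edge only the sign at the starting end `a` enters, hence uniqueness up to sign. The value
  -- at `b` fits continuously when the signs at the ends differ.
  let S : (V → ℂ) → ℂ → ℂ := fun c x =>
    if h : ∃ v, D.pt v = x then c h.choose
    else if h : ∃ e, ∃ _ : e ∈ G.edgeSet, x ∈ D.arc e then
      c (a _ h.choose_spec.choose) * E _ h.choose_spec.choose x
    else 1
  have hpt : ∀ c v, S c (D.pt v) = c v := by
    intro c v
    have h : ∃ w, D.pt w = D.pt v := ⟨v, rfl⟩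
    simp only [S, dif_pos h]
    rw [D.pt_injective h.choose_spec]
  have harc : ∀ c e (he : e ∈ G.edgeSet), ∀ x ∈ D.arc e, x ∉ range D.pt →
      S c x = c (a e he) * E e he x := by
    intro c e he x hx hxv
    have hxv' : ¬∃ v, D.pt v = x := hxv
    have h : ∃ e, ∃ _ : e ∈ G.edgeSet, x ∈ D.arc e := ⟨e, he, hx⟩
    have hcongr : ∀ e' (he' : e' ∈ G.edgeSet), e = e' →
        c (a e' he') * E e' he' x = c (a e he) * E e he x := by
      rintro _ _ rfl
      rfl
    have he' : e = h.choose := eq_of_mem_arc he h.choose_spec.choose hx h.choose_spec.choose_spec hxv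
    simp only [S]
    rw [dif_neg hxv', dif_pos h]
    exact hcongr _ _ he'
  have hval : ∀ x, (∃ v y, y ≠ 0 ∧ ∀ c, S c x = c v * y) ∨ ∀ c, S c x = 1 := by
    intro x
    by_cases hx : x ∈ range D.pt
    · obtain ⟨v, rfl⟩ := hx
      exact Or.inl ⟨v, 1, one_ne_zero, fun c => by rw [hpt, mul_one]⟩
    · by_cases h : ∃ e, ∃ _ : e ∈ G.edgeSet, x ∈ D.arc e
      · obtain ⟨e, he, hxe⟩ := h
        exact Or.inl ⟨a e he, E e he x, h0 e he x, fun c => harc c e he x hxe hx⟩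
      · right
        intro c
        simp only [S]
        rw [dif_neg (show ¬∃ v, D.pt v = x from hx), dif_neg h]
  refine ⟨S, hpt, fun c hc x => ?_, fun c c' hc hc' x => ?_, fun c u v huv hcuv => ?_⟩
  · rcases hval x with ⟨v, y, hy, h⟩ | h
    · rw [h]
      rcases hc v with h1 | h1 <;> simp [h1, hy]
    · simp [h]
  · rcases hval x with ⟨v, y, -, h⟩ | h
    · rw [h, h]
      rcases hc v with h1 | h1 <;> rcases hc' v with h2 | h2 <;> simp [h1, h2]
    · simp [h]
  · rw [← mem_edgeSet] at huv
    refine ((hE s(u, v) huv).const_mul (c (a _ huv))).congr fun x hx => ?_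
    by_cases hxv : x ∈ range D.pt
    · obtain ⟨w, rfl⟩ := hxv
      have hab := heq s(u, v) huv
      have hc : c (a _ huv) = -c (b _ huv) := by
        rcases Sym2.eq_iff.1 hab with ⟨h1, h2⟩ | ⟨h1, h2⟩
        · rw [← h1, ← h2, hcuv]
        · rw [← h1, ← h2, hcuv, neg_neg]
      have hw := D.mem_of_pt_mem_arc _ huv w hx
      rw [hab, Sym2.mem_iff] at hw
      rcases hw with rfl | rfl
      · simp only [hpt, ha, mul_one]
      · simp only [hpt, hb, hc, neg_mul_neg, mul_one]
    · exact harc c _ huv x hx hxv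

/-- A plane graph all of whose faces are bounded by even cycles is bipartite. -/
theorem HasEvenPolygonalFaces.exists_signs [Finite V] (hD : D.HasEvenPolygonalFaces) :
    ∃ c : V → ℂ, (∀ v, c v = 1 ∨ c v = -1) ∧ ∀ u v, G.Adj u v → c u = -c v := by
  obtain ⟨S, hSpt, hS0, hSS, hScont⟩ := D.exists_signExtension
  have hcol : ∀ Z : Set ℂ, ∃ c : V → ℂ, (∀ v, c v = 1 ∨ c v = -1) ∧
      ∀ f, D.IsFace f → Z = frontier f → ContinuousOn (S c) Z ∧
        ∀ u v, G.Adj u v → (∃ x ∈ Z, x ∈ D.arc s(u, v) ∧ x ∉ range D.pt) →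
          D.arc s(u, v) ⊆ Z ∧ c u = -c v := by
    intro Z
    by_cases hZ : ∃ f, D.IsFace f ∧ Z = frontier f
    · obtain ⟨f, hf, rfl⟩ := hZ
      obtain ⟨L, p, h3, hev, hp, hadj, hfr, -⟩ := hD.exists_zmod hf
      have : NeZero L := ⟨by lia⟩
      obtain ⟨c, hc, hcp⟩ := exists_alternating_sign hev hp
      refine ⟨c, hc, fun f' _ _ => ⟨?_, fun u v huv hx => ?_⟩⟩
      · rw [hfr]
        exact (locallyFinite_of_finite _).continuousOn_iUnion (fun i => D.isClosed_arc (hadj i))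
          fun i => hScont c _ _ (hadj i) (hcp i)
      · obtain ⟨x, hx, hxe, hxv⟩ := hx
        obtain ⟨i, hi⟩ := mem_iUnion.1 (hfr ▸ hx)
        have hsi := eq_of_mem_arc huv (hadj i) hxe hi hxv
        refine ⟨hfr ▸ hsi ▸ subset_iUnion (fun i => D.arc s(p i, p (i + 1))) i, ?_⟩
        rcases Sym2.eq_iff.1 hsi with ⟨rfl, rfl⟩ | ⟨rfl, rfl⟩
        · exact hcp i
        · rw [hcp i, neg_neg]
    -- The gluing lemma asks for nonvanishing functions at every index `Z`; constant signs serve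
    -- where `Z` is no frontier.
    · exact ⟨1, fun _ => Or.inl rfl, fun f hf h => absurd ⟨f, hf, h⟩ hZ⟩
  choose c hc hcZ using hcol
  obtain ⟨φ, hφ, hφs⟩ := exists_continuous_eq_or_eq_neg_on_frontier D.isClosed_support
    D.interior_support hD.finite_frontiers (s := fun Z => S (c Z))
    (fun z hz => (hcZ _ _ ⟨z, hz, rfl⟩ rfl).1) (fun Z => hS0 _ (hc Z))
    (fun Z Z' => hSS _ _ (hc Z) (hc Z'))
  have hpt : ∀ v, D.pt v ∈ D.support := fun v => Or.inl (mem_range_self v)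
  refine ⟨fun v => φ (D.pt v), fun v => ?_, fun u v huv => ?_⟩
  -- The index `∅` is arbitrary, since `φ` agrees up to sign with the function of every `Z`.
  · have h1 := hφs _ (hpt v) ∅
    rw [hSpt] at h1
    rcases h1 with h1 | h1 <;> rcases hc ∅ v with h2 | h2 <;> simp [h1, h2]
  · obtain ⟨f, hf, hx⟩ := hD.exists_isFace_of_mem_edgeSet (e := s(u, v)) huv
    obtain ⟨hcont, h⟩ := hcZ (frontier f) f hf rfl
    obtain ⟨hsub, hcuv⟩ := h u v huv hx
    obtain ⟨γ, -, hγ⟩ := D.isPlaneArc u v huv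
    have hconn : IsPreconnected (D.arc s(u, v)) := hγ ▸ isPreconnected_range γ.continuous
    have hq : ContinuousOn (fun x => φ x / S (c (frontier f)) x) (D.arc s(u, v)) :=
      hφ.continuousOn.div (hcont.mono hsub) fun x _ => hS0 _ (hc _) x
    have hmaps : MapsTo (fun x => φ x / S (c (frontier f)) x) (D.arc s(u, v)) {1, -1} := by
      intro x hx
      have h0 := hS0 _ (hc (frontier f)) x
      rcases hφs x (Or.inr (mem_biUnion (x := s(u, v)) huv hx)) (frontier f) with h1 | h1
      · left
        simp [h1, h0]
      · right
        simp [h1, h0]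
    have hconst := hconn.constant_of_mapsTo (T := {1, -1}) (toFinite _).isDiscrete
      hq hmaps (hγ ▸ ⟨0, γ.source⟩ : D.pt u ∈ _) (hγ ▸ ⟨1, γ.target⟩ : D.pt v ∈ _)
    have h0 : c (frontier f) v ≠ 0 := by
      rcases hc (frontier f) v with h | h <;> simp [h]
    simp only [hSpt, hcuv] at hconst
    rw [div_neg, ← neg_div, div_left_inj' h0] at hconst
    simp only [← hconst, neg_neg]

end SimpleGraph.PlaneDrawing

/-! ### Counting colors -/

namespace SimpleGraph

/-- A bipartite graph has at most twice as many vertices as an independent set. -/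
theorem natCard_le_two_mul_indepNum {V : Type*} [Finite V] {G : SimpleGraph V}
    (C : G.Coloring (Fin 2)) : Nat.card V ≤ 2 * G.indepNum := by
  classical
  have := Fintype.ofFinite V
  have h : ∀ a, (Finset.univ.filter fun v => C v = a).card ≤ G.indepNum := by
    refine fun a => IsIndepSet.card_le_indepNum fun u hu v hv _ huv => C.valid huv ?_
    simp only [Finset.coe_filter, Finset.mem_univ, true_and, mem_ofPred_eq] at hu hv
    rw [hu, hv]
  have hsum := Finset.card_eq_sum_card_fiberwise (f := C) (s := Finset.univ) (t := Finset.univ)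
    (fun _ _ => Finset.mem_univ _)
  rw [Fin.sum_univ_two] at hsum
  rw [Nat.card_eq_fintype_card, ← Finset.card_univ]
  have := h 0
  have := h 1
  lia

/-- The number of values of a surjective function is at most the average of the size of its domain
and the number of fibres with a single element. -/
theorem two_mul_le_natCard_add_card {V : Type*} [Fintype V] {k : ℕ} {C : V → Fin k}
    (hC : Function.Surjective C) [DecidablePred fun v => ∀ w, C w = C v → w = v] :
    2 * k ≤ Nat.card V + (Finset.univ.filter fun v => ∀ w, C w = C v → w = v).card := by
  classical
  set S := Finset.univ.filter fun v => ∀ w, C w = C v → w = v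
  rw [Nat.card_eq_fintype_card, ← Finset.card_univ,
    Finset.card_eq_sum_card_fiberwise (f := C) (s := Finset.univ) (t := Finset.univ)
      (fun _ _ => Finset.mem_univ _),
    Finset.card_eq_sum_card_fiberwise (f := C) (s := S) (t := Finset.univ)
      (fun _ _ => Finset.mem_univ _), ← Finset.sum_add_distrib]
  -- Each color counts at least twice: by two vertices, or by a single one that is counted again in
  -- `S`.
  have h : ∀ a ∈ (Finset.univ : Finset (Fin k)),
      2 ≤ (Finset.univ.filter fun v => C v = a).card + (S.filter fun v => C v = a).card := by
    intro a _
    obtain ⟨v, rfl⟩ := hC a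
    have h1 : 1 ≤ (Finset.univ.filter fun w => C w = C v).card :=
      Finset.card_pos.2 ⟨v, by simp⟩
    by_cases hv : ∀ w, C w = C v → w = v
    · have h2 : 1 ≤ (S.filter fun w => C w = C v).card :=
        Finset.card_pos.2 ⟨v, by simpa [S] using hv⟩
      lia
    · push Not at hv
      obtain ⟨w, hw, hwv⟩ := hv
      have h2 : 1 < (Finset.univ.filter fun w => C w = C v).card :=
        Finset.one_lt_card.2 ⟨w, by simpa using hw, v, by simp, hwv⟩
      lia
  have := Finset.card_nsmul_le_sum _ _ _ h
  simp only [Finset.card_univ, Fintype.card_fin, smul_eq_mul] at this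
  lia

namespace PlaneDrawing

variable {V : Type*} {G : SimpleGraph V} {D : G.PlaneDrawing}

theorem HasEvenPolygonalFaces.exists_adj [Finite V] (hD : D.HasEvenPolygonalFaces) :
    ∃ u v, G.Adj u v := by
  obtain ⟨z, hz⟩ : (D.supportᶜ).Nonempty := by
    rw [nonempty_compl]
    intro h
    simpa [h] using D.interior_support
  obtain ⟨L, p, -, -, -, hadj, -⟩ := hD.exists_zmod ⟨z, hz, rfl⟩
  exact ⟨_, _, hadj 0⟩

theorem HasEvenPolygonalFaces.exists_coloring_two [Finite V] (hD : D.HasEvenPolygonalFaces) :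
    ∃ C : G.Coloring (Fin 2), Function.Surjective C := by
  classical
  obtain ⟨c, hc, hcn⟩ := hD.exists_signs
  have hne : (1 : ℂ) ≠ -1 := by norm_num
  let C : G.Coloring (Fin 2) := Coloring.mk (fun v => if c v = 1 then 0 else 1) (by
    intro u v huv
    have := hcn u v huv
    rcases hc v with h | h <;> simp [this, h, hne.symm])
  obtain ⟨u, v, huv⟩ := hD.exists_adj
  refine ⟨C, fun a => ?_⟩
  have h := C.valid huv
  by_cases hu : C u = a
  · exact ⟨u, hu⟩
  · exact ⟨v, by lia⟩

theorem ncard_faceVertices_color {L : ℕ} {p : ZMod L → V} (hp : Function.Injective p) {f : Set ℂ}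
    (hf : D.faceVertices f = range p) {α : Type*} (C : V → α) (a : α) :
    (D.faceVertices f).ncard = L ∧
      {v ∈ D.faceVertices f | C v = a}.ncard = {i | C (p i) = a}.ncard := by
  constructor
  · rw [hf, ← image_univ, ncard_image_of_injective _ hp, ncard_univ, Nat.card_zmod]
  · rw [← ncard_image_of_injective {i | C (p i) = a} hp, hf]
    congr 1
    ext v
    constructor
    · rintro ⟨⟨i, rfl⟩, h⟩
      exact ⟨i, h, rfl⟩
    · rintro ⟨i, h, rfl⟩
      exact ⟨⟨i, rfl⟩, h⟩

theorem HasEvenPolygonalFaces.isHalfMonochromatic (hD : D.HasEvenPolygonalFaces)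
    (C : G.Coloring (Fin 2)) : D.IsHalfMonochromatic C := by
  intro f hf
  obtain ⟨L, p, h3, -, hp, hadj, -, hfv⟩ := hD.exists_zmod hf
  have : NeZero L := ⟨by lia⟩
  obtain ⟨h1, h2⟩ := ncard_faceVertices_color hp hfv C 0
  exact ⟨0, by
    rw [h1, h2, ZMod.two_mul_ncard_of_alternating (c := fun i => C (p i)) fun i => C.valid (hadj i)]⟩

/-- Two adjacent vertices cannot both be the only vertices of their colors. -/
theorem IsHalfMonochromatic.exists_color_eq [Finite V] (hD : D.HasEvenPolygonalFaces) {α : Type*}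
    {C : G.Coloring α} (hC : D.IsHalfMonochromatic C) {u v : V} (huv : G.Adj u v) :
    (∃ w, C w = C u ∧ w ≠ u) ∨ ∃ w, C w = C v ∧ w ≠ v := by
  obtain ⟨f, hf, x, hx, hxe, hxv⟩ := hD.exists_isFace_of_mem_edgeSet (e := s(u, v)) huv
  obtain ⟨L, p, h3, -, hp, hadj, hfr, hfv⟩ := hD.exists_zmod hf
  have : NeZero L := ⟨by lia⟩
  obtain ⟨i, hi⟩ := mem_iUnion.1 (hfr ▸ hx)
  have huvi := eq_of_mem_arc huv (hadj i) hxe hi hxv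
  obtain ⟨a, ha⟩ := hC f hf
  obtain ⟨h1, h2⟩ := ncard_faceVertices_color hp hfv C a
  rw [h1, h2] at ha
  have hother : ∀ j, C (p j) = a → ∃ w, C w = C (p j) ∧ w ≠ p j := by
    intro j hj
    -- Half of `L ≥ 3` exceeds 1, so the color `a` occurs again on the cycle.
    obtain ⟨l, hl, hlj⟩ := exists_ne_of_one_lt_ncard (s := {i | C (p i) = a}) (by lia) j
    exact ⟨p l, Eq.trans hl hj.symm, hp.ne hlj⟩
  have hcover := ZMod.mem_or_add_one_mem_of_ncard (T := {i | C (p i) = a})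
    (fun j hj hj' => C.valid (hadj j) (Eq.trans hj (Eq.symm hj'))) ha i
  rcases Sym2.eq_iff.1 huvi with ⟨rfl, rfl⟩ | ⟨rfl, rfl⟩
  · exact hcover.imp (hother _) (hother _)
  · exact hcover.symm.imp (hother _) (hother _)

theorem HasHalfMonochromaticColoring.two_mul_le [Finite V] (hD : D.HasEvenPolygonalFaces) {k : ℕ}
    (hk : D.HasHalfMonochromaticColoring k) : 2 * k ≤ 3 * G.indepNum := by
  classical
  have := Fintype.ofFinite V
  obtain ⟨C, hCs, hC⟩ := hk
  obtain ⟨B, -⟩ := hD.exists_coloring_two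
  have h1 := natCard_le_two_mul_indepNum B
  have h2 := two_mul_le_natCard_add_card hCs
  have h3 : (Finset.univ.filter fun v => ∀ w, C w = C v → w = v).card ≤ G.indepNum := by
    refine IsIndepSet.card_le_indepNum fun u hu v hv _ huv => ?_
    simp only [Finset.coe_filter, Finset.mem_univ, true_and, mem_ofPred_eq] at hu hv
    rcases hC.exists_color_eq hD huv with ⟨w, hw, hne⟩ | ⟨w, hw, hne⟩
    · exact hne (hu w hw)
    · exact hne (hv w hw)
  lia

end PlaneDrawing

end SimpleGraph

theorem theorem1p1 {V : Type*} [Finite V] (G : SimpleGraph V) (D : G.PlaneDrawing)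
    (hD : D.HasEvenPolygonalFaces) :
    IsGreatest {k | D.HasHalfMonochromaticColoring k} D.halfMonochromaticNumber ∧
      (D.halfMonochromaticNumber : ℝ) ≤ 3 / 2 * (G.indepNum : ℝ) := by
  have hne : {k | D.HasHalfMonochromaticColoring k}.Nonempty := by
    obtain ⟨C, hC⟩ := hD.exists_coloring_two
    exact ⟨2, C, hC, hD.isHalfMonochromatic C⟩
  have hle : ∀ k ∈ {k | D.HasHalfMonochromaticColoring k}, 2 * k ≤ 3 * G.indepNum :=
    fun k hk => hk.two_mul_le hD
  have hbdd : BddAbove {k | D.HasHalfMonochromaticColoring k} :=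
    ⟨3 * G.indepNum, fun k hk => by have := hle k hk; lia⟩
  have hmem := Nat.sSup_mem hne hbdd
  refine ⟨⟨hmem, fun k hk => le_csSup hbdd hk⟩, ?_⟩
  have h : (2 * D.halfMonochromaticNumber : ℝ) ≤ 3 * G.indepNum := by exact_mod_cast hle _ hmem
  linarith
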